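/- Let $N\ge 1$ and let $S$ be the annulus $(\mathbb R/N\mathbb Z)\times[0,1]$ with the marked points $A_i=(i,0)$ and $B_i=(i,1)$, $i\in\mathbb Z/N$, so $N$ marked points on each boundary component. Use the same symbols $A_i,B_i$, $i\in\mathbb Z$, for the lifts $(i,0),(i,1)$ of the marked points to the universal covering $\mathbb R\times[0,1]$. A point of the Teichmüller space $\mathcal T_N$ of $S$ is a marked hyperbolic structure on $S$ for which the marked points are ideal vertices and the boundary arcs are complete geodesics. It is recorded by its development up to isometry: ideal points $a_i,b_i\in\partial\mathbb H=\mathbb R\cup\{\infty\}$, $i\in\mathbb Z$ (the images of the lifts $A_i$, $B_i$), such that $v\mapsto$ image of $v$ preserves the cyclic order of the boundary (all $a_i$ in counterclockwise order of increasing $i$, followed by all $b_i$ in order of decreasing $i$, all of them distinct), and such that some $\gamma\in PSL(2,\mathbb R)$ satisfies $a_{i+N}=\gamma a_i$, $b_{i+N}=\gamma b_i$ for all $i$; two such families are identified if they differ by an element of $PSL(2,\mathbb R)$. The class of an orientation preserving homeomorphism $h$ of $S$ that preserves the set of marked points, up to isotopy through such homeomorphisms, acts on $\mathcal T_N$ by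 precomposing the development with the inverse of a lift of $h$. Let $D^{1/N}$ be the mapping class of $(x,y)\mapsto(x+y,y)$; it fixes every $A_i$, sends $B_i$ to $B_{i+1}$, and its $N$-th power is a Dehn twist. Triangulate $S$ by the ideal triangles $A_jA_{j+1}B_j$ and $A_{j+1}B_{j+1}B_j$. Its interior edges are numbered so that edge $2j-1$ is $A_jB_j$ and edge $2j$ is $A_{j+1}B_j$. The Fock coordinate of an interior edge, whose two adjacent triangles develop to an ideal quadrilateral with counterclockwise vertices $l,b,r,t$ and diagonal $tb$, is $$-\frac{(l-b)(r-t)}{(r-b)(l-t)}$$ (so it is $1/x$ for $(l,b,r,t)=(-1,0,x,\infty)$). Let $f_i$, $i\in\mathbb Z$, be the Fock coordinates, so $f_{i+2N}=f_i$. **Theorem.** 1. The Fock coordinates are global coordinates on $\mathcal T_N$ with values in the positive reals: $x\mapsto (f_i(x))_{i\in\mathbb Z}$ is a bijection of $\mathcal T_N$ onto the set of all $2N$-periodic sequences of positive reals. 2. In these coordinates, $D^{1/N}$ acts by $f_i\mapsto f_i'$, where $f_i'(x)=f_i(D^{1/N}x)$ and, for all $j\in\mathbb Z$, $$f'_{2j}=\frac1{f_{2j-1}},\qquad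 f'_{2j+1}=f_{2j}\,(1+f_{2j-1})(1+f_{2j+1}).$$ 3. There is a bijection $x\mapsto\chi(x)$ of $\mathcal T_N$ onto the set of all strictly positive functions $\chi_{m,n}$ on the sublattice $\{(m,n)\in\mathbb Z^2: m+n\equiv 1 \pmod 2\}$ that satisfy the discrete Liouville equation $$\chi_{m,n-1}\chi_{m,n+1}=(1+\chi_{m-1,n})(1+\chi_{m+1,n})\qquad (m+n\equiv 0 \pmod 2)$$ and the periodicity condition $\chi_{m+2N,n}=\chi_{m,n}$, such that the Fock coordinates are the initial data, $f_m(x)=\chi(x)_{m,0}$ for odd $m$ and $f_m(x)=1/\chi(x)_{m,-1}$ for even $m$, and such that $D^{1/N}$ is the translation along the light-cone: $$\chi(D^{1/N}x)_{m,n}=\chi(x)_{m-1,n+1}.$$ -/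

import Mathlib

open OnePoint Matrix

namespace AnnulusTeich

/-! ### The annulus with marked points, and its universal covering -/

/-- The universal covering `ℝ × [0,1]` of the annulus `(ℝ / Nℤ) × [0,1]`. The annulus is the
quotient by the deck group generated by `(x, y) ↦ (x + N, y)`. Its marked points are the images of
the points `(i, 0)` (called `A i`) and `(i, 1)` (called `B i`), `i ∈ ℤ`; so there are `N` marked
points on each of the two boundary components. -/
abbrev Strip : Type := ℝ × unitInterval

/-- The lifts to the strip of the marked points of the annulus. -/
inductive Marked : Type
  | A (i : ℤ) : Marked
  | B (i : ℤ) : Marked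

/-- The position of a lifted marked point in the strip. -/
def Marked.pos : Marked → Strip
  | .A i => ((i : ℝ), 0)
  | .B i => ((i : ℝ), 1)

theorem Marked.pos_injective : Function.Injective Marked.pos := by
  rintro (i | i) (j | j) h <;> simp [Marked.pos] at h <;> simp [h]

/-- Horizontal translation of the lifted marked points by `k`. -/
def Marked.shift (k : ℤ) : Marked → Marked
  | .A i => .A (i + k)
  | .B i => .B (i + k)

/-- The order in which the lifted marked points are met when the boundary of the strip is run
through with its boundary orientation: the line `y = 0` from left to right, then the line `y = 1`
from right to left. -/
def Marked.Before : Marked → Marked → Prop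
  | .A i, .A j => i < j
  | .A _, .B _ => True
  | .B _, .A _ => False
  | .B i, .B j => j < i

/-- The triple `P, Q, R` of lifted marked points is counterclockwise on the boundary of the
strip. -/
def Marked.Ccw (P Q R : Marked) : Prop :=
  (P.Before Q ∧ Q.Before R) ∨ (Q.Before R ∧ R.Before P) ∨ (R.Before P ∧ P.Before Q)

/-- Horizontal translation of the strip by `c`. -/
def translate (c : ℝ) : Strip ≃ₜ Strip :=
  (Homeomorph.addRight c).prodCongr (Homeomorph.refl _)

theorem translate_apply (c : ℝ) (x : Strip) : translate c x = (x.1 + c, x.2) := rfl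

theorem translate_pos (k : ℤ) (P : Marked) : translate k P.pos = (P.shift k).pos := by
  cases P <;> simp [translate_apply, Marked.pos, Marked.shift]

/-- A lift to the strip of an orientation preserving homeomorphism of the annulus that preserves
the set of marked points (not necessarily point-wise). The homeomorphisms of the annulus are
covered exactly by the homeomorphisms of the strip that normalize the deck group. -/
structure MarkedHomeo (N : ℕ) where
  /-- the homeomorphism of the strip -/
  toHomeo : Strip ≃ₜ Strip
  /-- the permutation that it induces on the lifted marked points -/
  perm : Equiv.Perm Marked
  map_pos : ∀ P : Marked, toHomeo P.pos = (perm P).pos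
  normalizes : (∀ x, toHomeo (translate N x) = translate N (toHomeo x)) ∨
    (∀ x, toHomeo (translate N x) = translate (-N) (toHomeo x))
  orientation : ∀ P Q R : Marked, P.Ccw Q R ↔ (perm P).Ccw (perm Q) (perm R)

/-- Isotopy of homeomorphisms of the annulus through homeomorphisms that preserve the set of marked
points, lifted to the strip. -/
def Isotopic {N : ℕ} (F G : MarkedHomeo N) : Prop :=
  ∃ H : unitInterval → MarkedHomeo N,
    Continuous (fun p : unitInterval × Strip => (H p.1).toHomeo p.2) ∧ H 0 = F ∧ H 1 = G

/-- `F` and `G` represent the same mapping class: some lift of the homeomorphism of the annulus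
covered by `F` is isotopic to `G`. -/
def SameClass {N : ℕ} (F G : MarkedHomeo N) : Prop :=
  ∃ (F' : MarkedHomeo N) (k : ℤ),
    (∀ x, F'.toHomeo x = translate (k * N) (F.toHomeo x)) ∧ Isotopic F' G

/-- The mapping classes of the annulus with `N` marked points on each boundary component. -/
def MappingClass (N : ℕ) : Type := Quot (SameClass (N := N))

/-- The homeomorphism `(x, y) ↦ (x + y, y)` of the strip. -/
def twistHomeo : Strip ≃ₜ Strip where
  toFun x := (x.1 + x.2, x.2)
  invFun x := (x.1 - x.2, x.2)
  left_inv x := by simp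
  right_inv x := by simp
  continuous_toFun := by fun_prop
  continuous_invFun := by fun_prop

/-- The twist of the annulus that is the identity on the boundary component carrying the `A i` and
is the shift by one spacing on the other one: `A i ↦ A i` and `B i ↦ B (i + 1)`. -/
def twist (N : ℕ) : MarkedHomeo N where
  toHomeo := twistHomeo
  perm :=
    { toFun := fun P => match P with
        | .A i => .A i
        | .B i => .B (i + 1)
      invFun := fun P => match P with
        | .A i => .A i
        | .B i => .B (i - 1)
      left_inv := by rintro (i | i) <;> simp
      right_inv := by rintro (i | i) <;> simp }
  map_pos := by rintro (i | i) <;> simp [twistHomeo, Marked.pos]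
  normalizes := Or.inl fun x => by
    change ((x.1 + N + x.2 : ℝ), x.2) = (x.1 + x.2 + N, x.2)
    rw [add_right_comm]
  orientation := by
    rintro (i | i) (j | j) (k | k) <;> simp [Marked.Ccw, Marked.Before]

/-- The mapping class `D^{1/N}`. -/
def rootTwist (N : ℕ) : MappingClass N := Quot.mk _ (twist N)

/-! ### Ideal points of the hyperbolic plane -/

/-- The Möbius action of `SL(2, ℝ)` on the boundary `ℝ ∪ {∞}` of the upper half plane. -/
noncomputable def moebius (g : SpecialLinearGroup (Fin 2) ℝ) (p : OnePoint ℝ) : OnePoint ℝ :=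
  (g : GL (Fin 2) ℝ) • p

/-- The determinant `p₁ q₂ - p₂ q₁` of the homogeneous coordinates `(x, 1)` of `x ∈ ℝ` and `(1, 0)`
of `∞`; so it is `p - q` if `p` and `q` are real. -/
noncomputable def bracket (p q : OnePoint ℝ) : ℝ :=
  p.elim 1 id * q.elim 0 (fun _ => 1) - p.elim 0 (fun _ => 1) * q.elim 1 id

/-- The triple `p, q, r` of ideal points is (strictly) counterclockwise on the boundary of the upper
half plane, which is the direction of increasing reals. -/
def Ccw (p q r : OnePoint ℝ) : Prop := 0 < bracket p q * bracket q r * bracket r p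

/-- The Fock coordinate of the diagonal `top`–`bottom` of an ideal quadrilateral whose
counterclockwise vertices are `left, bottom, right, top`. It is normalized so that `-1, 0, x, ∞` has
the coordinate `1 / x`. -/
noncomputable def crossRatio (top bottom left right : OnePoint ℝ) : ℝ :=
  -(bracket left bottom * bracket right top) / (bracket right bottom * bracket left top)

/-! ### Teichmüller space -/

/-- A hyperbolic structure on the annulus in which the marked points are ideal vertices and the
boundary arcs between consecutive marked points are complete geodesics, given by a developing map
and its holonomy: `vertex P` is the ideal end point of the developed lifted marked point `P`, the
holonomy of the generator of the fundamental group is in `PSL(2, ℝ)`, and the development preserves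
the cyclic order of the boundary. The hyperbolic surface is the quotient by the holonomy of the
ideal region of the upper half plane spanned by the points `vertex P`, and the labels of the
vertices are the marking. -/
structure HypStructure (N : ℕ) where
  vertex : Marked → OnePoint ℝ
  ccw : ∀ P Q R : Marked, P.Ccw Q R → Ccw (vertex P) (vertex Q) (vertex R)
  holonomy : ∃ γ : SpecialLinearGroup (Fin 2) ℝ,
    ∀ P : Marked, vertex (P.shift N) = moebius γ (vertex P)

/-- Two hyperbolic structures are equivalent if their developments differ by an orientation
preserving isometry of the upper half plane. -/
def HypStructure.Equivalent {N : ℕ} (X Y : HypStructure N) : Prop :=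
  ∃ g : SpecialLinearGroup (Fin 2) ℝ, ∀ P : Marked, Y.vertex P = moebius g (X.vertex P)

/-- The Teichmüller space of the annulus with `N` marked points on each boundary component. -/
def Teich (N : ℕ) : Type := Quot (HypStructure.Equivalent (N := N))

/-! ### The action of mapping classes -/

theorem Marked.shift_zero (P : Marked) : P.shift 0 = P := by
  cases P <;> simp [Marked.shift]

theorem Marked.shift_shift (k l : ℤ) (P : Marked) : (P.shift k).shift l = P.shift (k + l) := by
  cases P <;> simp [Marked.shift, add_assoc]

theorem moebius_one (p : OnePoint ℝ) : moebius 1 p = p := by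
  simp [moebius]

theorem moebius_mul (g h : SpecialLinearGroup (Fin 2) ℝ) (p : OnePoint ℝ) :
    moebius (g * h) p = moebius g (moebius h p) := by
  simp [moebius, mul_smul]

theorem moebius_inv_eq (g : SpecialLinearGroup (Fin 2) ℝ) (p q : OnePoint ℝ)
    (h : q = moebius g p) : moebius g⁻¹ q = p := by
  rw [h, ← moebius_mul, inv_mul_cancel, moebius_one]

theorem MarkedHomeo.perm_shift {N : ℕ} (F : MarkedHomeo N) :
    (∀ P, F.perm (P.shift N) = (F.perm P).shift N) ∨
      (∀ P, F.perm (P.shift N) = (F.perm P).shift (-N)) := by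
  rcases F.normalizes with h | h
  · refine Or.inl fun P => Marked.pos_injective ?_
    have := h P.pos
    rw [F.map_pos] at this
    have e := translate_pos N P
    have e' := translate_pos N (F.perm P)
    push_cast at e e'
    rw [← F.map_pos, ← e, this, e']
  · refine Or.inr fun P => Marked.pos_injective ?_
    have := h P.pos
    rw [F.map_pos] at this
    have e := translate_pos N P
    have e' := translate_pos (-N) (F.perm P)
    push_cast at e e'
    rw [← F.map_pos, ← e, this, e']

/-- The push-forward of a hyperbolic structure by a homeomorphism of the annulus: the development
is precomposed with the inverse of the lifted homeomorphism. -/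
def MarkedHomeo.push {N : ℕ} (F : MarkedHomeo N) (X : HypStructure N) : HypStructure N where
  vertex P := X.vertex (F.perm.symm P)
  ccw P Q R h := X.ccw _ _ _ ((F.orientation _ _ _).2 (by simpa using h))
  holonomy := by
    obtain ⟨γ, hγ⟩ := X.holonomy
    rcases F.perm_shift with h | h
    · refine ⟨γ, fun P => ?_⟩
      rw [← hγ]
      congr 1
      rw [Equiv.symm_apply_eq, h, Equiv.apply_symm_apply]
    · refine ⟨γ⁻¹, fun P => (moebius_inv_eq _ _ _ ?_).symm⟩
      rw [← hγ]
      congr 1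
      rw [Equiv.symm_apply_eq, h, Equiv.apply_symm_apply, Marked.shift_shift, add_neg_cancel,
        Marked.shift_zero]

/-- The action of a homeomorphism of the annulus on the Teichmüller space. -/
def MarkedHomeo.act {N : ℕ} (F : MarkedHomeo N) : Teich N → Teich N :=
  Quot.map F.push fun _ _ ⟨g, hg⟩ => ⟨g, fun P => hg (F.perm.symm P)⟩

theorem HypStructure.vertex_shift {N : ℕ} (X : HypStructure N) (k : ℤ) :
    ∃ g : SpecialLinearGroup (Fin 2) ℝ,
      ∀ P : Marked, X.vertex (P.shift (k * N)) = moebius g (X.vertex P) := by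
  obtain ⟨γ, hγ⟩ := X.holonomy
  induction k using Int.induction_on with
  | zero => exact ⟨1, fun P => by rw [zero_mul, Marked.shift_zero, moebius_one]⟩
  | succ k ih =>
    obtain ⟨g, hg⟩ := ih
    refine ⟨γ * g, fun P => ?_⟩
    rw [moebius_mul, ← hg, ← hγ, Marked.shift_shift, add_mul, one_mul]
  | pred k ih =>
    obtain ⟨g, hg⟩ := ih
    refine ⟨γ⁻¹ * g, fun P => ?_⟩
    rw [moebius_mul, ← hg]
    refine (moebius_inv_eq _ _ _ ?_).symm
    rw [← hγ, Marked.shift_shift, sub_mul, one_mul, sub_add_cancel]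

theorem Isotopic.perm_eq {N : ℕ} {F G : MarkedHomeo N} (h : Isotopic F G) : F.perm = G.perm := by
  obtain ⟨H, hc, rfl, rfl⟩ := h
  ext1 P
  apply Marked.pos_injective
  rw [← MarkedHomeo.map_pos, ← MarkedHomeo.map_pos]
  have hP : Continuous fun t : unitInterval => (H t).toHomeo P.pos :=
    hc.comp (Continuous.prodMk_left P.pos)
  have hr : ∀ t, ∃ k : ℤ × ℤ, (((H t).toHomeo P.pos).1, (((H t).toHomeo P.pos).2 : ℝ)) =
      ((k.1 : ℝ), (k.2 : ℝ)) := by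
    intro t
    rw [MarkedHomeo.map_pos]
    rcases (H t).perm P with i | i
    · exact ⟨(i, 0), by simp [Marked.pos]⟩
    · exact ⟨(i, 1), by simp [Marked.pos]⟩
  have key : ∀ u : unitInterval → ℝ, Continuous u → (∀ t, ∃ k : ℤ, u t = k) → u 0 = u 1 := by
    intro u hu hk
    exact isPreconnected_univ.constant_of_mapsTo (T := Set.range ((↑) : ℤ → ℝ))
      Int.isClosedEmbedding_coe_real.isInducing.isDiscrete_range hu.continuousOn (fun t _ => by obtain ⟨k, hk⟩ := hk t; exact ⟨k, hk.symm⟩)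
      trivial trivial
  refine Prod.ext (key _ (continuous_fst.comp hP) fun t => ?_)
    (Subtype.ext (key _ (continuous_subtype_val.comp (continuous_snd.comp hP)) fun t => ?_))
  · obtain ⟨k, hk⟩ := hr t
    exact ⟨k.1, congrArg Prod.fst hk⟩
  · obtain ⟨k, hk⟩ := hr t
    exact ⟨k.2, congrArg Prod.snd hk⟩

theorem SameClass.act_eq {N : ℕ} {F G : MarkedHomeo N} (h : SameClass F G) : F.act = G.act := by
  obtain ⟨F', k, hk, hi⟩ := h
  have hG := hi.perm_eq
  have hperm : ∀ P, G.perm P = (F.perm P).shift (k * N) := fun P => by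
    apply Marked.pos_injective
    have e := translate_pos (k * N) (F.perm P)
    push_cast at e
    rw [← hG, ← MarkedHomeo.map_pos, hk, F.map_pos, e]
  funext x
  induction x using Quot.ind with
  | mk X =>
    refine Quot.sound ?_
    obtain ⟨g, hg⟩ := (F.push X).vertex_shift (-k)
    refine ⟨g, fun P => ?_⟩
    rw [← hg]
    change X.vertex _ = X.vertex _
    congr 1
    rw [Equiv.symm_apply_eq, hperm, Equiv.apply_symm_apply, Marked.shift_shift, neg_mul,
      neg_add_cancel, Marked.shift_zero]

/-- The action of a mapping class on the Teichmüller space. -/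
def MappingClass.act {N : ℕ} (D : MappingClass N) : Teich N → Teich N :=
  Quot.lift MarkedHomeo.act (fun _ _ h => h.act_eq) D

/-! ### Fock coordinates -/

/-- The Fock coordinate of the `i`-th interior edge of the ideal triangulation of the annulus whose
triangles are the images of `A j, A (j+1), B j` and `A (j+1), B (j+1), B j`, for `j ∈ ℤ`.
The edge `2 j - 1` joins `A j` to `B j` and the edge `2 j` joins `A (j+1)` to `B j`. -/
noncomputable def HypStructure.fock {N : ℕ} (X : HypStructure N) (i : ℤ) : ℝ :=
  if Even i then
    crossRatio (X.vertex (.B (i / 2))) (X.vertex (.A (i / 2 + 1)))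
      (X.vertex (.A (i / 2))) (X.vertex (.B (i / 2 + 1)))
  else
    crossRatio (X.vertex (.B ((i + 1) / 2))) (X.vertex (.A ((i + 1) / 2)))
      (X.vertex (.B ((i + 1) / 2 - 1))) (X.vertex (.A ((i + 1) / 2 + 1)))

theorem bracket_moebius (g : SpecialLinearGroup (Fin 2) ℝ) :
    ∃ c : OnePoint ℝ → ℝ, (∀ p, c p ≠ 0) ∧
      ∀ p q, c p * c q * bracket (moebius g p) (moebius g q) = bracket p q := by
  have hdet : g 0 0 * g 1 1 - g 0 1 * g 1 0 = 1 := by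
    rw [← Matrix.det_fin_two, g.det_coe]
  have key : ∀ p : OnePoint ℝ, ∃ c : ℝ, c ≠ 0 ∧
      c * (moebius g p).elim 1 id = g 0 0 * p.elim 1 id + g 0 1 * p.elim 0 (fun _ => 1) ∧
      c * (moebius g p).elim 0 (fun _ => 1) =
        g 1 0 * p.elim 1 id + g 1 1 * p.elim 0 (fun _ => 1) := by
    intro p
    cases p with
    | infty =>
      by_cases h : g 1 0 = 0
      · refine ⟨g 0 0, fun h0 => ?_, ?_, ?_⟩
        · simp [h, h0] at hdet
        all_goals simp [moebius, smul_infty_eq_ite, h]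
      · refine ⟨g 1 0, h, ?_, ?_⟩
        all_goals simp [moebius, smul_infty_eq_ite, h]
        field_simp
    | coe x =>
      by_cases h : g 1 0 * x + g 1 1 = 0
      · refine ⟨g 0 0 * x + g 0 1, fun h0 => ?_, ?_, ?_⟩
        · exact one_ne_zero (hdet.symm.trans (by linear_combination g 0 0 * h - g 1 0 * h0))
        all_goals simp [moebius, smul_some_eq_ite, h]
      · refine ⟨g 1 0 * x + g 1 1, h, ?_, ?_⟩
        all_goals simp [moebius, smul_some_eq_ite, h]
        field_simp
  choose c hc h1 h2 using key
  refine ⟨c, hc, fun p q => ?_⟩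
  unfold bracket
  linear_combination (c q * (moebius g q).elim 0 (fun _ => 1)) * h1 p +
    (g 0 0 * p.elim 1 id + g 0 1 * p.elim 0 (fun _ => 1)) * h2 q -
    (c q * (moebius g q).elim 1 id) * h2 p -
    (g 1 0 * p.elim 1 id + g 1 1 * p.elim 0 (fun _ => 1)) * h1 q +
    (p.elim 1 id * q.elim 0 (fun _ => 1) - p.elim 0 (fun _ => 1) * q.elim 1 id) * hdet

theorem crossRatio_moebius (g : SpecialLinearGroup (Fin 2) ℝ) (t b l r : OnePoint ℝ) :
    crossRatio (moebius g t) (moebius g b) (moebius g l) (moebius g r) = crossRatio t b l r := by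
  obtain ⟨c, hc, h⟩ := bracket_moebius g
  unfold crossRatio
  rw [← h l b, ← h r t, ← h r b, ← h l t]
  rw [show -(c l * c b * bracket (moebius g l) (moebius g b) *
      (c r * c t * bracket (moebius g r) (moebius g t))) = (c l * c b * c r * c t) *
      -(bracket (moebius g l) (moebius g b) * bracket (moebius g r) (moebius g t)) by ring,
    show c r * c b * bracket (moebius g r) (moebius g b) *
      (c l * c t * bracket (moebius g l) (moebius g t)) = (c l * c b * c r * c t) *
      (bracket (moebius g r) (moebius g b) * bracket (moebius g l) (moebius g t)) by ring,
    mul_div_mul_left _ _ (mul_ne_zero (mul_ne_zero (mul_ne_zero (hc l) (hc b)) (hc r)) (hc t))]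

/-- The Fock coordinates `f_i`, `i ∈ ℤ`, of a point of the Teichmüller space. -/
noncomputable def Teich.fock {N : ℕ} (x : Teich N) : ℤ → ℝ :=
  Quot.lift HypStructure.fock (fun X Y ⟨g, hg⟩ => by
    funext i
    simp only [HypStructure.fock, hg, crossRatio_moebius]) x

/-! ### The discrete Liouville equation -/

theorem odd_down {m n : ℤ} (h : Even (m + n)) : Odd (m + (n - 1)) := by
  grind

theorem odd_up {m n : ℤ} (h : Even (m + n)) : Odd (m + (n + 1)) := by
  grind

theorem odd_left {m n : ℤ} (h : Even (m + n)) : Odd (m - 1 + n) := by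
  grind

theorem odd_right {m n : ℤ} (h : Even (m + n)) : Odd (m + 1 + n) := by
  grind

theorem odd_period {m n : ℤ} (N : ℕ) (h : Odd (m + n)) : Odd (m + 2 * N + n) := by
  grind

theorem odd_lightCone {m n : ℤ} (h : Odd (m + n)) : Odd (m - 1 + (n + 1)) := by
  grind

theorem odd_zero {m : ℤ} (h : Odd m) : Odd (m + 0) := by
  grind

theorem odd_neg_one {m : ℤ} (h : Even m) : Odd (m + (-1)) := by
  grind

/-- The strictly positive `2 N`-periodic solutions of the discrete Liouville equation on the
sublattice of all `(m, n) ∈ ℤ²` with `m + n` odd. -/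
@[ext]
structure LiouvilleSolution (N : ℕ) where
  val : ∀ m n : ℤ, Odd (m + n) → ℝ
  pos : ∀ (m n : ℤ) (h : Odd (m + n)), 0 < val m n h
  liouville : ∀ (m n : ℤ) (h : Even (m + n)),
    val m (n - 1) (odd_down h) * val m (n + 1) (odd_up h) =
      (1 + val (m - 1) n (odd_left h)) * (1 + val (m + 1) n (odd_right h))
  periodic : ∀ (m n : ℤ) (h : Odd (m + n)), val (m + 2 * N) n (odd_period N h) = val m n h

end AnnulusTeich

open AnnulusTeich

namespace AnnulusTeich

/-! ### Brackets and cross ratios -/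

/-! Everything is computed with brackets, the 2×2 determinants of homogeneous coordinates. A Möbius
map rescales them by one factor per point, and they satisfy the Plücker relation.

Rigidity (`eq_of_fockOf_eq`): an isometry matches one developed triangle with another, and each Fock
coordinate then fixes the next vertex across an edge, in both directions along the triangulation.

Existence (`exists_fockOf_eq`): run through the vertices in the zigzag …, A 0, B 0, A 1, B 1, ….
They are lifted to plane vectors with s (k + 2) = s k + e k * s (k + 1) and e k > 0. Each Fock
coordinate is a product of two consecutive e's, or its inverse, so e can be solved for; positivity
of e forces the cyclic order. For periodic coordinates the shifted development has the same
coordinates, so rigidity itself supplies the holonomy.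

The twist flips all odd edges at once; `crossRatio_flip` and `one_add_crossRatio` give the
coordinate change. Put χ_{m,n} = f_{m+n}(Dⁿ x), where D is the root twist. The two transformation
rules combine into the Liouville equation, the light-cone translation is built into the index m + n,
and rows 0 and -1 of χ are the Fock coordinates of x. Since a solution is determined by these rows
(`LiouvilleSolution.ext_initial`), bijectivity reduces to that of the Fock coordinates. -/

theorem bracket_swap (p q : OnePoint ℝ) : bracket q p = -bracket p q := by
  unfold bracket
  ring

theorem eq_of_bracket_eq_zero {p q : OnePoint ℝ} (h : bracket p q = 0) : p = q := by
  cases p <;> cases q <;> simp [bracket] at h ⊢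
  linarith

theorem Ccw.bracket_ne_zero {p q r : OnePoint ℝ} (h : Ccw p q r) :
    bracket p q ≠ 0 ∧ bracket q r ≠ 0 ∧ bracket r p ≠ 0 := by
  unfold Ccw at h
  refine ⟨?_, ?_, ?_⟩ <;> intro h0 <;> simp [h0] at h

/-- Multiplying the two orientation inequalities leaves the square of the diagonal's bracket times
the sign of the cross ratio. -/
theorem crossRatio_pos {t b l r : OnePoint ℝ} (h1 : Ccw l b t) (h2 : Ccw b r t) :
    0 < crossRatio t b l r := by
  obtain ⟨hlb, hbt, htl⟩ := h1.bracket_ne_zero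
  obtain ⟨hbr, hrt, -⟩ := h2.bracket_ne_zero
  have h := mul_pos h1 h2
  rw [bracket_swap b t] at h
  have h3 : 0 < (bracket b t) ^ 2 *
      (-(bracket l b * bracket r t) * (bracket r b * bracket l t)) := by
    rw [bracket_swap b r, bracket_swap t l]
    linarith
  have h4 := pos_of_mul_pos_right h3 (sq_nonneg _)
  unfold crossRatio
  rw [← mul_div_mul_right _ _ (c := bracket r b * bracket l t)]
  · exact div_pos h4 (mul_self_pos.2 (by
      rw [bracket_swap b r, bracket_swap t l]; simp [hbr, htl]))
  · rw [bracket_swap b r, bracket_swap t l]; simp [hbr, htl]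

/-- This is the Plücker relation: adding 1 turns the cross ratio into another monomial in the
brackets. -/
theorem one_add_crossRatio {t b l r : OnePoint ℝ} (hrb : bracket r b ≠ 0) (hlt : bracket l t ≠ 0) :
    1 + crossRatio t b l r = -(bracket l r * bracket b t) / (bracket r b * bracket l t) := by
  unfold crossRatio
  rw [eq_div_iff (mul_ne_zero hrb hlt), add_mul, div_mul_cancel₀ _ (mul_ne_zero hrb hlt)]
  unfold bracket
  ring

/-- After cross-multiplication, the Plücker relation factors the difference as a nonzero multiple of
`bracket r r'`. -/
theorem crossRatio_right_injective {t b l r r' : OnePoint ℝ} (hlb : bracket l b ≠ 0)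
    (hlt : bracket l t ≠ 0) (htb : bracket t b ≠ 0) (hrb : bracket r b ≠ 0)
    (hrb' : bracket r' b ≠ 0) (h : crossRatio t b l r = crossRatio t b l r') : r = r' := by
  unfold crossRatio at h
  rw [div_eq_div_iff (mul_ne_zero hrb hlt) (mul_ne_zero hrb' hlt)] at h
  have h1 : (bracket l b * bracket l t) * (bracket r t * bracket r' b - bracket r' t * bracket r b)
      = 0 := by linear_combination -h
  have h2 : (bracket l b * bracket l t) * (bracket t b * bracket r r') = 0 := by
    rw [← h1]
    unfold bracket
    ring
  exact eq_of_bracket_eq_zero (by simpa [hlb, hlt, htb] using h2)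

theorem crossRatio_left_right_swap (t b l r : OnePoint ℝ) :
    crossRatio t b l r = crossRatio b t r l := by
  unfold crossRatio
  rw [mul_comm (bracket r t), mul_comm (bracket l t)]

theorem crossRatio_left_injective {t b l l' r : OnePoint ℝ} (hrt : bracket r t ≠ 0)
    (hrb : bracket r b ≠ 0) (hbt : bracket b t ≠ 0) (hlt : bracket l t ≠ 0)
    (hlt' : bracket l' t ≠ 0) (h : crossRatio t b l r = crossRatio t b l' r) : l = l' := by
  rw [crossRatio_left_right_swap, crossRatio_left_right_swap t] at h
  exact crossRatio_right_injective hrt hrb hbt hlt hlt' h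

/-! ### Homogeneous coordinates -/

/-- The ideal point with the homogeneous coordinates `(x, y)`. -/
noncomputable def ofHomog (x y : ℝ) : OnePoint ℝ :=
  -- The pair (0, 0) is also sent to ∞, so the lemma recovering the coordinates must exclude it.
  if y = 0 then ∞ else ((x / y : ℝ) : OnePoint ℝ)

theorem ofHomog_elim {x y : ℝ} (h : x ≠ 0 ∨ y ≠ 0) : ∃ c : ℝ, c ≠ 0 ∧
    c * (ofHomog x y).elim 1 id = x ∧ c * (ofHomog x y).elim 0 (fun _ => 1) = y := by
  by_cases hy : y = 0
  · exact ⟨x, by simpa [hy] using h, by simp [ofHomog, hy], by simp [ofHomog, hy]⟩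
  · exact ⟨y, hy, by simp [ofHomog, hy]; field_simp, by simp [ofHomog, hy]⟩

theorem ofHomog_eq {c x y : ℝ} {p : OnePoint ℝ} (hc : c ≠ 0) (hx : c * p.elim 1 id = x)
    (hy : c * p.elim 0 (fun _ => 1) = y) : ofHomog x y = p := by
  subst hx hy
  cases p <;> simp [ofHomog, hc]

/-- `∞`, `0` and `1` can be moved to any counterclockwise triple of ideal points. -/
theorem Ccw.exists_moebius_standard {p q r : OnePoint ℝ} (h : Ccw p q r) :
    ∃ g : SpecialLinearGroup (Fin 2) ℝ,
      moebius g ∞ = p ∧ moebius g ((0 : ℝ) : OnePoint ℝ) = q ∧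
        moebius g ((1 : ℝ) : OnePoint ℝ) = r := by
  obtain ⟨hpq, hqr, hrp⟩ := h.bracket_ne_zero
  set s := √(bracket p q * bracket q r * bracket r p) with hs
  have hs0 : 0 < s := Real.sqrt_pos.2 h
  have hss : s * s = bracket p q * bracket q r * bracket r p := Real.mul_self_sqrt h.le
  have hcp : -bracket q r / s ≠ 0 := div_ne_zero (neg_ne_zero.2 hqr) hs0.ne'
  have hcq : -bracket r p / s ≠ 0 := div_ne_zero (neg_ne_zero.2 hrp) hs0.ne'
  have hcr : bracket p q / s ≠ 0 := div_ne_zero hpq hs0.ne'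
  -- The columns represent p and q, weighted so that by the relation [qr]p + [rp]q + [pq]r = 0 their
  -- sum represents r. The determinant is the orientation product over s², which is 1 because that
  -- product is positive and s is its root.
  let M : Matrix (Fin 2) (Fin 2) ℝ :=
    !![-bracket q r / s * p.elim 1 id, -bracket r p / s * q.elim 1 id;
      -bracket q r / s * p.elim 0 (fun _ => 1), -bracket r p / s * q.elim 0 (fun _ => 1)]
  have hM : M.det = 1 := by
    rw [Matrix.det_fin_two_of]
    have : -bracket q r / s * p.elim 1 id * (-bracket r p / s * q.elim 0 (fun _ => 1)) -
        -bracket r p / s * q.elim 1 id * (-bracket q r / s * p.elim 0 (fun _ => 1)) =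
        bracket p q * bracket q r * bracket r p / (s * s) := by
      unfold bracket
      ring
    rw [this, ← hss, div_self (by positivity)]
  have hinf : ∀ g : SpecialLinearGroup (Fin 2) ℝ, moebius g ∞ = ofHomog (g 0 0) (g 1 0) := by
    intro g
    simp only [moebius, smul_infty_eq_ite, ofHomog]
    congr
  have hcoe : ∀ (g : SpecialLinearGroup (Fin 2) ℝ) (x : ℝ), moebius g (x : OnePoint ℝ) =
      ofHomog (g 0 0 * x + g 0 1) (g 1 0 * x + g 1 1) := by
    intro g x
    simp only [moebius, smul_some_eq_ite, ofHomog]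
    congr
  let g : SpecialLinearGroup (Fin 2) ℝ := ⟨M, hM⟩
  refine ⟨g, ?_, ?_, ?_⟩
  · rw [hinf]
    exact ofHomog_eq hcp rfl rfl
  · rw [hcoe]
    exact ofHomog_eq hcq (by simp [g, M]) (by simp [g, M])
  · rw [hcoe]
    refine ofHomog_eq hcr ?_ ?_ <;> simp [g, M, bracket] <;> ring

theorem Ccw.exists_moebius {p q r p' q' r' : OnePoint ℝ} (h : Ccw p q r) (h' : Ccw p' q' r') :
    ∃ g : SpecialLinearGroup (Fin 2) ℝ, moebius g p = p' ∧ moebius g q = q' ∧ moebius g r = r' := by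
  obtain ⟨g, rfl, rfl, rfl⟩ := h.exists_moebius_standard
  obtain ⟨g', rfl, rfl, rfl⟩ := h'.exists_moebius_standard
  refine ⟨g' * g⁻¹, ?_, ?_, ?_⟩ <;>
    rw [← moebius_mul, mul_assoc, inv_mul_cancel, mul_one]

/-- Each point enters two of the three brackets, so the product changes only by a square. -/
theorem Ccw.moebius {p q r : OnePoint ℝ} (g : SpecialLinearGroup (Fin 2) ℝ) (h : Ccw p q r) :
    Ccw (moebius g p) (moebius g q) (moebius g r) := by
  obtain ⟨c, hc, hb⟩ := bracket_moebius g
  unfold Ccw at h ⊢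
  rw [← hb p q, ← hb q r, ← hb r p] at h
  refine pos_of_mul_pos_right (a := (c p * c q * c r) ^ 2) ?_ (sq_nonneg _)
  linarith

/-! ### Rigidity of developments -/

/-- The Fock coordinates of a development. -/
noncomputable def fockOf (v : Marked → OnePoint ℝ) (i : ℤ) : ℝ :=
  if Even i then
    crossRatio (v (.B (i / 2))) (v (.A (i / 2 + 1))) (v (.A (i / 2))) (v (.B (i / 2 + 1)))
  else
    crossRatio (v (.B ((i + 1) / 2))) (v (.A ((i + 1) / 2)))
      (v (.B ((i + 1) / 2 - 1))) (v (.A ((i + 1) / 2 + 1)))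

theorem fockOf_even (v : Marked → OnePoint ℝ) (j : ℤ) :
    fockOf v (2 * j) = crossRatio (v (.B j)) (v (.A (j + 1))) (v (.A j)) (v (.B (j + 1))) := by
  simp [fockOf]

theorem fockOf_odd (v : Marked → OnePoint ℝ) (j : ℤ) :
    fockOf v (2 * j - 1) = crossRatio (v (.B j)) (v (.A j)) (v (.B (j - 1))) (v (.A (j + 1))) := by
  have h : ¬Even (2 * j - 1) := by grind
  simp [fockOf, h]

theorem fockOf_odd' (v : Marked → OnePoint ℝ) (j : ℤ) :
    fockOf v (2 * j + 1) =
      crossRatio (v (.B (j + 1))) (v (.A (j + 1))) (v (.B j)) (v (.A (j + 2))) := by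
  have := fockOf_odd v (j + 1)
  rwa [show 2 * (j + 1) - 1 = 2 * j + 1 by ring, add_sub_cancel_right, add_assoc] at this

theorem fockOf_moebius (g : SpecialLinearGroup (Fin 2) ℝ) (v : Marked → OnePoint ℝ) :
    fockOf (fun P => moebius g (v P)) = fockOf v := by
  funext i
  simp only [fockOf, crossRatio_moebius]

/-- Every pair of distinct marked points is part of a counterclockwise triple, so a development
that preserves the cyclic order separates marked points. -/
theorem Marked.exists_ccw {P Q : Marked} (h : P ≠ Q) : ∃ R, P.Ccw Q R ∨ Q.Ccw P R := by
  rcases P with i | i <;> rcases Q with j | j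
  · refine ⟨.B 0, ?_⟩
    simp only [Marked.Ccw, Marked.Before]
    have : i ≠ j := fun e => h (by rw [e])
    grind
  · exact ⟨.A (i + 1), Or.inr (by simp [Marked.Ccw, Marked.Before])⟩
  · exact ⟨.A (j + 1), Or.inl (by simp [Marked.Ccw, Marked.Before])⟩
  · refine ⟨.A 0, ?_⟩
    simp only [Marked.Ccw, Marked.Before]
    have : i ≠ j := fun e => h (by rw [e])
    grind

theorem bracket_vertex_ne_zero {v : Marked → OnePoint ℝ}
    (hv : ∀ P Q R : Marked, P.Ccw Q R → Ccw (v P) (v Q) (v R)) {P Q : Marked} (h : P ≠ Q) :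
    bracket (v P) (v Q) ≠ 0 := by
  obtain ⟨R, hR | hR⟩ := Marked.exists_ccw h
  · exact (hv _ _ _ hR).bracket_ne_zero.1
  · rw [bracket_swap]
    exact neg_ne_zero.2 (hv _ _ _ hR).bracket_ne_zero.1

theorem fockOf_pos {v : Marked → OnePoint ℝ}
    (hv : ∀ P Q R : Marked, P.Ccw Q R → Ccw (v P) (v Q) (v R)) (i : ℤ) : 0 < fockOf v i := by
  rcases Int.even_or_odd' i with ⟨j, rfl | rfl⟩
  · rw [fockOf_even]
    exact crossRatio_pos (hv _ _ _ (by simp [Marked.Ccw, Marked.Before]))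
      (hv _ _ _ (by simp [Marked.Ccw, Marked.Before]))
  · rw [fockOf_odd']
    exact crossRatio_pos (hv _ _ _ (by simp [Marked.Ccw, Marked.Before]))
      (hv _ _ _ (by simp [Marked.Ccw, Marked.Before]))

/-- Starting from a common triangle, the even and odd coordinates alternately determine the fourth
vertex of the next quadrilateral. Forwards this is the right vertex, backwards the left one. -/
theorem eq_of_fockOf_eq {v w : Marked → OnePoint ℝ}
    (hv : ∀ P Q R : Marked, P.Ccw Q R → Ccw (v P) (v Q) (v R))
    (hw : ∀ P Q R : Marked, P.Ccw Q R → Ccw (w P) (w Q) (w R))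
    (h : fockOf v = fockOf w) (hA : v (.A 0) = w (.A 0)) (hB : v (.B 0) = w (.B 0))
    (hA' : v (.A 1) = w (.A 1)) : v = w := by
  have key : ∀ j : ℤ, v (.A j) = w (.A j) ∧ v (.B j) = w (.B j) ∧
      v (.A (j + 1)) = w (.A (j + 1)) := by
    intro j
    induction j using Int.induction_on with
    | zero => exact ⟨hA, hB, by simpa using hA'⟩
    | succ k ih =>
      obtain ⟨h1, h2, h3⟩ := ih
      generalize (k : ℤ) = j at h1 h2 h3 ⊢
      have h4 : v (.B (j + 1)) = w (.B (j + 1)) := by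
        have e := congrFun h (2 * j)
        rw [fockOf_even, fockOf_even, ← h1, ← h2, ← h3] at e
        refine crossRatio_right_injective ?_ ?_ ?_ ?_ ?_ e
        pick_goal 5
        · rw [h3]
          exact bracket_vertex_ne_zero hw (by simp)
        all_goals exact bracket_vertex_ne_zero hv (by simp)
      refine ⟨h3, h4, ?_⟩
      have e := congrFun h (2 * j + 1)
      rw [fockOf_odd', fockOf_odd', ← h2, ← h3, ← h4] at e
      rw [add_assoc]
      refine crossRatio_right_injective ?_ ?_ ?_ ?_ ?_ e
      pick_goal 5
      · rw [h3]
        exact bracket_vertex_ne_zero hw (by simp)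
      all_goals exact bracket_vertex_ne_zero hv (by simp)
    | pred k ih =>
      obtain ⟨h1, h2, h3⟩ := ih
      generalize (-k : ℤ) = j at h1 h2 h3 ⊢
      have h4 : v (.B (j - 1)) = w (.B (j - 1)) := by
        have e := congrFun h (2 * j - 1)
        rw [fockOf_odd, fockOf_odd, ← h1, ← h2, ← h3] at e
        refine crossRatio_left_injective ?_ ?_ ?_ ?_ ?_ e
        pick_goal 5
        · rw [h2]
          exact bracket_vertex_ne_zero hw (by simp)
        all_goals exact bracket_vertex_ne_zero hv (by simp)
      refine ⟨?_, h4, by rwa [sub_add_cancel]⟩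
      have e := congrFun h (2 * (j - 1))
      rw [fockOf_even, fockOf_even, sub_add_cancel, ← h1, ← h2, ← h4] at e
      refine crossRatio_left_injective ?_ ?_ ?_ ?_ ?_ e
      pick_goal 5
      · rw [h4]
        exact bracket_vertex_ne_zero hw (by simp)
      all_goals exact bracket_vertex_ne_zero hv (by grind)
  funext P
  rcases P with i | i
  · exact (key i).1
  · exact (key i).2.1

/-- A development is determined by its Fock coordinates up to isometry. -/
theorem exists_moebius_of_fockOf_eq {v w : Marked → OnePoint ℝ}
    (hv : ∀ P Q R : Marked, P.Ccw Q R → Ccw (v P) (v Q) (v R))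
    (hw : ∀ P Q R : Marked, P.Ccw Q R → Ccw (w P) (w Q) (w R))
    (h : fockOf v = fockOf w) :
    ∃ g : SpecialLinearGroup (Fin 2) ℝ, ∀ P, w P = moebius g (v P) := by
  have hc : Marked.Ccw (.A 0) (.A 1) (.B 0) := by simp [Marked.Ccw, Marked.Before]
  obtain ⟨g, h1, h2, h3⟩ := (hv _ _ _ hc).exists_moebius (hw _ _ _ hc)
  have := eq_of_fockOf_eq (v := fun P => moebius g (v P))
    (fun P Q R hPQR => (hv P Q R hPQR).moebius g) hw (by rw [fockOf_moebius, h]) h1 h3 h2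
  exact ⟨g, fun P => (congrFun this P).symm⟩

/-! ### Developments with prescribed Fock coordinates -/

/-- Adding the time as a coordinate makes the recurrence autonomous; integer powers of the single
permutation `τ` then run it in both directions. -/
theorem exists_int_orbit {S : Type*} (σ : ℤ → Equiv.Perm S) (s₀ : S) :
    ∃ s : ℤ → S, s 0 = s₀ ∧ ∀ k, s (k + 1) = σ k (s k) := by
  let τ : Equiv.Perm (ℤ × S) :=
    { toFun := fun x => (x.1 + 1, σ x.1 x.2)
      invFun := fun x => (x.1 - 1, (σ (x.1 - 1)).symm x.2)
      left_inv := fun x => by simp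
      right_inv := fun x => by simp }
  have hstep : ∀ k : ℤ, (τ ^ (k + 1)) (0, s₀) = τ ((τ ^ k) (0, s₀)) := fun k => by
    rw [add_comm, _root_.zpow_one_add, Equiv.Perm.mul_apply]
  have hfst : ∀ k : ℤ, ((τ ^ k) (0, s₀)).1 = k := by
    intro k
    induction k using Int.induction_on with
    | zero => rfl
    | succ k ih => rw [hstep]; exact congrArg (· + 1) ih
    | pred k ih =>
      have h := hstep (-k - 1)
      rw [sub_add_cancel] at h
      have h1 : ((τ ^ (-k : ℤ)) (0, s₀)).1 = ((τ ^ (-k - 1 : ℤ)) (0, s₀)).1 + 1 := by rw [h]; rfl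
      linarith
  refine ⟨fun k => ((τ ^ k) (0, s₀)).2, rfl, fun k => ?_⟩
  dsimp only
  rw [hstep]
  exact congrArg (fun i => σ i ((τ ^ k) (0, s₀)).2) (hfst k)

theorem exists_pos_consecutive_mul_eq (g : ℤ → ℝ) (hg : ∀ k, 0 < g k) :
    ∃ e : ℤ → ℝ, (∀ k, 0 < e k) ∧ ∀ k, e k * e (k + 1) = g k := by
  let σ : ℤ → Equiv.Perm {x : ℝ // 0 < x} := fun k =>
    { toFun := fun x => ⟨g k / x, div_pos (hg k) x.2⟩
      invFun := fun x => ⟨g k / x, div_pos (hg k) x.2⟩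
      left_inv := fun x => Subtype.ext (div_div_cancel₀ (hg k).ne')
      right_inv := fun x => Subtype.ext (div_div_cancel₀ (hg k).ne') }
  obtain ⟨s, -, hs⟩ := exists_int_orbit σ ⟨1, one_pos⟩
  refine ⟨fun k => s k, fun k => (s k).2, fun k => ?_⟩
  dsimp only
  rw [hs]
  exact mul_div_cancel₀ _ (s k).2.ne'

theorem exists_linear_recurrence (e : ℤ → ℝ) (a b : ℝ) :
    ∃ s : ℤ → ℝ, s 0 = a ∧ s 1 = b ∧ ∀ k, s (k + 2) = s k + e k * s (k + 1) := by
  let σ : ℤ → Equiv.Perm (ℝ × ℝ) := fun k =>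
    { toFun := fun x => (x.2, x.1 + e k * x.2)
      invFun := fun x => (x.2 - e k * x.1, x.1)
      left_inv := fun x => by simp
      right_inv := fun x => by simp }
  obtain ⟨s, h0, hs⟩ := exists_int_orbit σ (a, b)
  have h1 : ∀ k, (s (k + 1)).1 = (s k).2 := fun k => by rw [hs]; rfl
  refine ⟨fun k => (s k).1, by simp [h0], ?_, fun k => ?_⟩
  · have := h1 0
    simpa [h0] using this
  · dsimp only
    rw [show k + 2 = k + 1 + 1 by ring, h1 (k + 1), h1 k, hs]
    rfl

/-- The determinant of the `i`-th and the `j`-th vector of a sequence in the plane. -/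
def wedge (p q : ℤ → ℝ) (i j : ℤ) : ℝ := p i * q j - p j * q i

theorem wedge_swap (p q : ℤ → ℝ) (i j : ℤ) : wedge p q j i = -wedge p q i j := by
  unfold wedge
  ring

theorem wedge_self (p q : ℤ → ℝ) (i : ℤ) : wedge p q i i = 0 := by
  unfold wedge
  ring

theorem wedge_add_two {e p q : ℤ → ℝ} (hp : ∀ k, p (k + 2) = p k + e k * p (k + 1))
    (hq : ∀ k, q (k + 2) = q k + e k * q (k + 1))
    (i k : ℤ) :
    wedge p q i (k + 2) = wedge p q i k + e k * wedge p q i (k + 1) := by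
  unfold wedge
  rw [hp, hq]
  ring

/-- The step (s k, s (k + 1)) ↦ (s (k + 1), s (k + 2)) has determinant -1. -/
theorem wedge_succ_succ {e p q : ℤ → ℝ} (hp : ∀ k, p (k + 2) = p k + e k * p (k + 1))
    (hq : ∀ k, q (k + 2) = q k + e k * q (k + 1))
    (k : ℤ) : wedge p q (k + 1) (k + 2) = -wedge p q k (k + 1) := by
  unfold wedge
  rw [hp, hq]
  ring

theorem wedge_consecutive {e p q : ℤ → ℝ} (hp : ∀ k, p (k + 2) = p k + e k * p (k + 1))
    (hq : ∀ k, q (k + 2) = q k + e k * q (k + 1))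
    (h0 : wedge p q 0 1 = -1) (j : ℤ) :
    wedge p q (2 * j) (2 * j + 1) = -1 ∧ wedge p q (2 * j + 1) (2 * j + 2) = 1 := by
  have key : wedge p q (2 * j) (2 * j + 1) = -1 := by
    induction j using Int.induction_on with
    | zero => simpa using h0
    | succ k ih =>
      have h1 := wedge_succ_succ hp hq (2 * k)
      have h2 := wedge_succ_succ hp hq (2 * k + 1)
      rw [show (2 * k + 1 + 1 : ℤ) = 2 * k + 2 by ring] at h2
      rw [show (2 * ((k : ℤ) + 1)) = 2 * k + 2 by ring,
        show (2 * (k : ℤ) + 2 + 1) = 2 * k + 1 + 2 by ring, h2, h1, ih]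
      norm_num
    | pred k ih =>
      have h1 := wedge_succ_succ hp hq (2 * (-k - 1))
      have h2 := wedge_succ_succ hp hq (2 * (-k - 1) + 1)
      rw [show (2 * (-k - 1) + 1 + 1 : ℤ) = 2 * (-k - 1) + 2 by ring, h1,
        show (2 * (-(k : ℤ) - 1) + 2) = 2 * -k by ring,
        show (2 * (-(k : ℤ) - 1) + 1 + 2) = 2 * -k + 1 by ring, ih] at h2
      linarith
  exact ⟨key, by rw [wedge_succ_succ hp hq, key, neg_neg]⟩

/-- For fixed i the wedge solves the same recurrence in j, starting from 0; positive coefficients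
preserve the sign of the first nonzero term. -/
theorem wedge_mul_pos {e p q : ℤ → ℝ} (hp : ∀ k, p (k + 2) = p k + e k * p (k + 1))
    (hq : ∀ k, q (k + 2) = q k + e k * q (k + 1))
    (he : ∀ k, 0 < e k) {i j : ℤ} (hij : i < j)
    (hi : wedge p q i (i + 1) ≠ 0) : 0 < wedge p q i (i + 1) * wedge p q i j := by
  -- Two consecutive terms are carried; the first inequality is weak because the term at n = 0
  -- vanishes.
  have key : ∀ n : ℕ, 0 ≤ wedge p q i (i + 1) * wedge p q i (i + n) ∧
      0 < wedge p q i (i + 1) * wedge p q i (i + n + 1) := by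
    intro n
    induction n with
    | zero => simp [wedge_self, hi]
    | succ n ih =>
      push_cast
      rw [← add_assoc]
      refine ⟨ih.2.le, ?_⟩
      rw [show i + n + 1 + 1 = i + n + 2 by ring, wedge_add_two hp hq, mul_add, mul_left_comm]
      exact add_pos_of_nonneg_of_pos ih.1 (mul_pos (he _) ih.2)
  obtain ⟨n, rfl⟩ := Int.le.dest (Int.add_one_le_of_lt hij)
  have := (key n).2
  rwa [add_right_comm] at this

/-- The place of a marked point in the zigzag `…, A 0, B 0, A 1, B 1, …`. -/
def Marked.index : Marked → ℤ
  | .A i => 2 * i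
  | .B i => 2 * i + 1

theorem Marked.Before.trans {P Q R : Marked} (h : P.Before Q) (h' : Q.Before R) : P.Before R := by
  rcases P with i | i <;> rcases Q with j | j <;> rcases R with k | k <;>
    simp only [Marked.Before] at * <;> omega

/-- The sign of the wedge with increasing indices depends on the parity of the smaller index. The
boundary order runs backwards along the B's, and these two reversals cancel. -/
theorem wedge_index_neg {e p q : ℤ → ℝ} (hp : ∀ k, p (k + 2) = p k + e k * p (k + 1))
    (hq : ∀ k, q (k + 2) = q k + e k * q (k + 1)) (he : ∀ k, 0 < e k)
    (h0 : wedge p q 0 1 = -1) {P Q : Marked} (h : P.Before Q) :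
    wedge p q P.index Q.index < 0 := by
  have heven : ∀ i j : ℤ, 2 * i < j → wedge p q (2 * i) j < 0 := fun i j hij => by
    have h1 := (wedge_consecutive hp hq h0 i).1
    have := wedge_mul_pos hp hq he hij (by rw [h1]; norm_num)
    rw [h1] at this
    linarith
  have hodd : ∀ i j : ℤ, 2 * i + 1 < j → 0 < wedge p q (2 * i + 1) j := fun i j hij => by
    have h1 := (wedge_consecutive hp hq h0 i).2
    rw [show 2 * i + 2 = 2 * i + 1 + 1 by ring] at h1
    have := wedge_mul_pos hp hq he hij (by rw [h1]; norm_num)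
    rw [h1] at this
    linarith
  rcases P with i | i <;> rcases Q with j | j <;> simp only [Marked.Before, Marked.index] at h ⊢
  · exact heven _ _ (by omega)
  · rcases lt_or_ge (2 * i) (2 * j + 1) with hij | hij
    · exact heven _ _ hij
    · rw [wedge_swap, neg_lt_zero]
      exact hodd _ _ (by omega)
  · rw [wedge_swap, neg_lt_zero]
    exact hodd _ _ (by omega)

/-- Every sequence of positive reals is the sequence of Fock coordinates of a development. -/
theorem exists_fockOf_eq (f : ℤ → ℝ) (hf : ∀ i, 0 < f i) :
    ∃ v : Marked → OnePoint ℝ, (∀ P Q R : Marked, P.Ccw Q R → Ccw (v P) (v Q) (v R)) ∧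
      fockOf v = f := by
  -- The four vertices of edge k have indices k, …, k + 3. Brackets of indices two apart carry the
  -- e's; they lie in the numerator for even k and in the denominator for odd k, hence the inverse.
  obtain ⟨e, he, hef⟩ := exists_pos_consecutive_mul_eq
    (fun k => if Even k then f k else (f k)⁻¹) fun k => by
      split_ifs
      · exact hf k
      · exact inv_pos.2 (hf k)
  -- These initial values put A 0 at 0 and B 0 at ∞, with first wedge -1.
  obtain ⟨p, hp0, hp1, hp⟩ := exists_linear_recurrence e 0 1
  obtain ⟨q, hq0, hq1, hq⟩ := exists_linear_recurrence e 1 0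
  have h0 : wedge p q 0 1 = -1 := by simp [wedge, hp0, hp1, hq0, hq1]
  have hcons := wedge_consecutive hp hq h0
  have hne : ∀ k, p k ≠ 0 ∨ q k ≠ 0 := by
    intro k
    by_contra! h
    rcases Int.even_or_odd' k with ⟨j, rfl | rfl⟩
    · have := (hcons j).1
      simp [wedge, h.1, h.2] at this
    · have := (hcons j).2
      simp [wedge, h.1, h.2] at this
  choose c hc h1 h2 using fun P : Marked => ofHomog_elim (hne P.index)
  let v : Marked → OnePoint ℝ := fun P => ofHomog (p P.index) (q P.index)
  have hb : ∀ P Q : Marked, c P * c Q * bracket (v P) (v Q) = wedge p q P.index Q.index := by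
    intro P Q
    unfold wedge bracket
    linear_combination (c Q * (v Q).elim 0 (fun _ => 1)) * h1 P + p P.index * h2 Q -
      (c Q * (v Q).elim 1 id) * h2 P - q P.index * h1 Q
  have hneg : ∀ {P Q : Marked}, P.Before Q → wedge p q P.index Q.index < 0 := fun h =>
    wedge_index_neg hp hq he h0 h
  have hord : ∀ P Q R : Marked, P.Before Q → Q.Before R →
      0 < bracket (v P) (v Q) * bracket (v Q) (v R) * bracket (v R) (v P) := by
    intro P Q R hPQ hQR
    have h := mul_pos (mul_pos_of_neg_of_neg (hneg hPQ) (hneg hQR))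
      (neg_pos.2 (hneg (hPQ.trans hQR)))
    rw [← wedge_swap, ← hb, ← hb, ← hb] at h
    refine pos_of_mul_pos_right (a := (c P * c Q * c R) ^ 2) ?_ (sq_nonneg _)
    linarith
  have hcr : ∀ t b l r : Marked, crossRatio (v t) (v b) (v l) (v r) =
      -(wedge p q l.index b.index * wedge p q r.index t.index) /
        (wedge p q r.index b.index * wedge p q l.index t.index) := by
    intro t b l r
    rw [← hb, ← hb, ← hb, ← hb, crossRatio,
      ← mul_div_mul_left _ _ (mul_ne_zero (mul_ne_zero (hc l) (hc b)) (mul_ne_zero (hc r) (hc t)))]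
    congr 1 <;> ring
  refine ⟨v, ?_, ?_⟩
  · rintro P Q R (⟨h, h'⟩ | ⟨h, h'⟩ | ⟨h, h'⟩)
    · exact hord P Q R h h'
    · have := hord Q R P h h'
      unfold Ccw
      linarith
    · have := hord R P Q h h'
      unfold Ccw
      linarith
  · have hskip : ∀ k, wedge p q k (k + 2) = e k * wedge p q k (k + 1) := fun k => by
      rw [wedge_add_two hp hq, wedge_self, zero_add]
    funext i
    rcases Int.even_or_odd' i with ⟨j, rfl | rfl⟩
    · have h3 := hef (2 * j)
      have hs := hskip (2 * j)
      have hs' := hskip (2 * j + 1)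
      have hw := (hcons (j + 1)).1
      rw [show 2 * j + 1 + 2 = 2 * (j + 1) + 1 by ring,
        show 2 * j + 1 + 1 = 2 * j + 2 by ring, (hcons j).2] at hs'
      rw [(hcons j).1, show 2 * j + 2 = 2 * (j + 1) by ring] at hs
      rw [if_pos (by simp)] at h3
      rw [fockOf_even, hcr]
      simp only [Marked.index]
      rw [hs, wedge_swap p q (2 * j + 1) (2 * (j + 1) + 1), hs', (hcons j).1,
        wedge_swap p q (2 * (j + 1)), hw, ← h3]
      ring
    · have h3 := hef (2 * j + 1)
      have hs := hskip (2 * j + 1)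
      have hs' := hskip (2 * (j + 1))
      rw [show 2 * j + 1 + 2 = 2 * (j + 1) + 1 by ring,
        show 2 * j + 1 + 1 = 2 * j + 2 by ring, (hcons j).2] at hs
      rw [(hcons (j + 1)).1] at hs'
      have hw := (hcons (j + 1)).2
      have hw' := (hcons j).2
      rw [show 2 * j + 2 = 2 * (j + 1) by ring] at hw'
      rw [if_neg (by simp), show 2 * j + 1 + 1 = 2 * (j + 1) by ring] at h3
      rw [fockOf_odd', hcr]
      simp only [Marked.index]
      rw [show 2 * (j + 2) = 2 * (j + 1) + 2 by ring, hw', wedge_swap p q (2 * (j + 1) + 1), hw,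
        wedge_swap p q (2 * (j + 1)), hs', hs, ← inv_inv (f (2 * j + 1)), ← h3]
      have e1 := (he (2 * j + 1)).ne'
      have e2 := (he (2 * (j + 1))).ne'
      field_simp

/-! ### Fock coordinates as coordinates on Teichmüller space -/

theorem HypStructure.fock_eq_fockOf {N : ℕ} (X : HypStructure N) : X.fock = fockOf X.vertex := rfl

theorem fockOf_shift (v : Marked → OnePoint ℝ) (k i : ℤ) :
    fockOf (fun P => v (P.shift k)) i = fockOf v (i + 2 * k) := by
  rcases Int.even_or_odd' i with ⟨j, rfl | rfl⟩
  · rw [fockOf_even, show 2 * j + 2 * k = 2 * (j + k) by ring, fockOf_even]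
    simp only [Marked.shift, add_right_comm]
  · rw [fockOf_odd', show 2 * j + 1 + 2 * k = 2 * (j + k) + 1 by ring, fockOf_odd']
    simp only [Marked.shift, add_right_comm]

theorem Marked.Ccw.shift {P Q R : Marked} (h : P.Ccw Q R) (k : ℤ) :
    (P.shift k).Ccw (Q.shift k) (R.shift k) := by
  have hb : ∀ P Q : Marked, (P.shift k).Before (Q.shift k) ↔ P.Before Q := by
    rintro (i | i) (j | j) <;> simp [Marked.shift, Marked.Before]
  simpa only [Marked.Ccw, hb] using h

theorem HypStructure.fock_periodic {N : ℕ} (X : HypStructure N) (i : ℤ) :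
    X.fock (i + 2 * N) = X.fock i := by
  obtain ⟨γ, hγ⟩ := X.holonomy
  rw [X.fock_eq_fockOf, ← fockOf_shift, funext hγ, fockOf_moebius]

theorem Teich.fock_pos {N : ℕ} (x : Teich N) (i : ℤ) : 0 < x.fock i := by
  induction x using Quot.ind with
  | mk X => exact fockOf_pos X.ccw i

theorem Teich.fock_periodic {N : ℕ} (x : Teich N) (i : ℤ) : x.fock (i + 2 * N) = x.fock i := by
  induction x using Quot.ind with
  | mk X => exact X.fock_periodic i

theorem Teich.fock_injective (N : ℕ) : Function.Injective (Teich.fock (N := N)) := by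
  intro x y h
  induction x using Quot.ind with
  | mk X =>
    induction y using Quot.ind with
    | mk Y => exact Quot.sound (exists_moebius_of_fockOf_eq X.ccw Y.ccw h)

theorem Teich.exists_fock_eq {N : ℕ} (f : ℤ → ℝ) (hf : ∀ i, 0 < f i)
    (hper : ∀ i, f (i + 2 * N) = f i) : ∃ x : Teich N, x.fock = f := by
  obtain ⟨v, hv, rfl⟩ := exists_fockOf_eq f hf
  -- The holonomy is the isometry that rigidity gives between the development and its shift by N.
  -- The auxiliary sequence e need not be periodic.
  refine ⟨Quot.mk _ ⟨v, hv, exists_moebius_of_fockOf_eq hv (fun P Q R h => hv _ _ _ (h.shift N)) ?_⟩,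
    rfl⟩
  funext i
  rw [fockOf_shift, hper]

theorem Teich.range_fock (N : ℕ) : Set.range (Teich.fock (N := N)) =
    {f : ℤ → ℝ | (∀ i, 0 < f i) ∧ ∀ i, f (i + 2 * N) = f i} := by
  ext f
  constructor
  · rintro ⟨x, rfl⟩
    exact ⟨x.fock_pos, x.fock_periodic⟩
  · rintro ⟨hf, hper⟩
    exact Teich.exists_fock_eq f hf hper

/-! ### The action of mapping classes -/

/-- The pull-back of a hyperbolic structure by a homeomorphism of the annulus. -/
def MarkedHomeo.pull {N : ℕ} (F : MarkedHomeo N) (X : HypStructure N) : HypStructure N where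
  vertex P := X.vertex (F.perm P)
  ccw P Q R h := X.ccw _ _ _ ((F.orientation _ _ _).1 h)
  holonomy := by
    obtain ⟨γ, hγ⟩ := X.holonomy
    rcases F.perm_shift with h | h
    · exact ⟨γ, fun P => by rw [h, hγ]⟩
    · refine ⟨γ⁻¹, fun P => (moebius_inv_eq _ _ _ ?_).symm⟩
      rw [← hγ, h, Marked.shift_shift, neg_add_cancel, Marked.shift_zero]

/-- The action of a homeomorphism of the annulus on the Teichmüller space, as a permutation. -/
def MarkedHomeo.actEquiv {N : ℕ} (F : MarkedHomeo N) : Equiv.Perm (Teich N) where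
  toFun := F.act
  invFun := Quot.map F.pull fun _ _ ⟨g, hg⟩ => ⟨g, fun P => hg (F.perm P)⟩
  left_inv x := by
    induction x using Quot.ind with
    | mk X =>
      refine Quot.sound ⟨1, fun P => ?_⟩
      rw [moebius_one]
      exact congrArg X.vertex (F.perm.symm_apply_apply P).symm
  right_inv x := by
    induction x using Quot.ind with
    | mk X =>
      refine Quot.sound ⟨1, fun P => ?_⟩
      rw [moebius_one]
      exact congrArg X.vertex (F.perm.apply_symm_apply P).symm

/-- A quarter turn of the quadrilateral exchanges numerator and denominator. -/
theorem crossRatio_flip (t b l r : OnePoint ℝ) : crossRatio l r b t = 1 / crossRatio t b l r := by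
  unfold crossRatio
  rw [one_div_div, bracket_swap r b, bracket_swap l t, bracket_swap r t, bracket_swap l b,
    ← neg_div_neg_eq]
  congr 1 <;> ring

/-- The inverse twist carries edge 2j to the segment from A (j+1) to B (j-1), the other diagonal of
the quadrilateral of edge 2j-1. -/
theorem fock_push_twist_even {N : ℕ} (X : HypStructure N) (j : ℤ) :
    ((twist N).push X).fock (2 * j) = 1 / X.fock (2 * j - 1) := by
  rw [HypStructure.fock_eq_fockOf, HypStructure.fock_eq_fockOf, fockOf_even, fockOf_odd,
    ← crossRatio_flip]
  change crossRatio (X.vertex (.B (j - 1))) (X.vertex (.A (j + 1))) (X.vertex (.A j))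
    (X.vertex (.B (j + 1 - 1))) = _
  rw [add_sub_cancel_right]

/-- The inverse twist carries edge 2j+1 to edge 2j, but the neighbouring edges 2j-1 and 2j+1 have
been flipped; each flip contributes one factor. -/
theorem fock_push_twist_odd {N : ℕ} (X : HypStructure N) (j : ℤ) :
    ((twist N).push X).fock (2 * j + 1) =
      X.fock (2 * j) * (1 + X.fock (2 * j - 1)) * (1 + X.fock (2 * j + 1)) := by
  have hne : ∀ {P Q : Marked}, P ≠ Q → bracket (X.vertex P) (X.vertex Q) ≠ 0 := fun h =>
    bracket_vertex_ne_zero X.ccw h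
  simp only [HypStructure.fock_eq_fockOf]
  rw [fockOf_even, fockOf_odd, fockOf_odd', fockOf_odd']
  change crossRatio (X.vertex (.B (j + 1 - 1))) (X.vertex (.A (j + 1))) (X.vertex (.B (j - 1)))
    (X.vertex (.A (j + 2))) = _
  -- Rewriting both factors 1 + f as monomials leaves only cancellation of brackets.
  rw [add_sub_cancel_right,
    one_add_crossRatio (hne (by simp)) (hne (by simp)),
    one_add_crossRatio (hne (by simp)) (hne (by simp))]
  have h1 : bracket (X.vertex (.A (j + 1))) (X.vertex (.A j)) ≠ 0 := hne (by simp)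
  have h2 : bracket (X.vertex (.B (j - 1))) (X.vertex (.B j)) ≠ 0 := hne (by simp)
  have h3 : bracket (X.vertex (.A (j + 2))) (X.vertex (.A (j + 1))) ≠ 0 := hne (by simp)
  have h4 : bracket (X.vertex (.B j)) (X.vertex (.B (j + 1))) ≠ 0 := hne (by simp)
  have h5 : bracket (X.vertex (.A j)) (X.vertex (.B j)) ≠ 0 := hne (by simp)
  have h6 : bracket (X.vertex (.B (j + 1))) (X.vertex (.A (j + 1))) ≠ 0 := hne (by simp)
  unfold crossRatio
  rw [bracket_swap (X.vertex (.A (j + 1))) (X.vertex (.A j)),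
    bracket_swap (X.vertex (.B j)) (X.vertex (.B (j + 1))),
    bracket_swap (X.vertex (.B (j + 1))) (X.vertex (.A (j + 1))),
    bracket_swap (X.vertex (.A (j + 2))) (X.vertex (.B j))]
  field_simp

/-- The mapping class `D^{1/N}` as a permutation of the Teichmüller space. -/
def rootTwistEquiv (N : ℕ) : Equiv.Perm (Teich N) := (twist N).actEquiv

theorem fock_rootTwist_even {N : ℕ} (x : Teich N) (j : ℤ) :
    (rootTwistEquiv N x).fock (2 * j) = 1 / x.fock (2 * j - 1) := by
  induction x using Quot.ind with
  | mk X => exact fock_push_twist_even X j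

theorem fock_rootTwist_odd {N : ℕ} (x : Teich N) (j : ℤ) :
    (rootTwistEquiv N x).fock (2 * j + 1) =
      x.fock (2 * j) * (1 + x.fock (2 * j - 1)) * (1 + x.fock (2 * j + 1)) := by
  induction x using Quot.ind with
  | mk X => exact fock_push_twist_odd X j

/-! ### Solutions of the discrete Liouville equation -/

/-- Two adjacent rows determine the next row on either side, since the positive factor of the
Liouville product can be cancelled. -/
theorem LiouvilleSolution.ext_initial {N : ℕ} {χ ψ : LiouvilleSolution N}
    (h0 : ∀ (m : ℤ) (h : Odd m), χ.val m 0 (odd_zero h) = ψ.val m 0 (odd_zero h))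
    (h1 : ∀ (m : ℤ) (h : Even m), χ.val m (-1) (odd_neg_one h) = ψ.val m (-1) (odd_neg_one h)) :
    χ = ψ := by
  have key : ∀ n : ℤ, (∀ (m : ℤ) (h : Odd (m + n)), χ.val m n h = ψ.val m n h) ∧
      ∀ (m : ℤ) (h : Odd (m + (n - 1))), χ.val m (n - 1) h = ψ.val m (n - 1) h := by
    intro n
    induction n using Int.induction_on with
    | zero => exact ⟨fun m h => h0 m (by simpa using h), fun m h => h1 m (by
        rw [Int.odd_iff] at h
        rw [Int.even_iff]
        omega)⟩
    | succ k ih =>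
      obtain ⟨ih0, ih1⟩ := ih
      generalize (k : ℤ) = n at ih0 ih1 ⊢
      simp only [add_sub_cancel_right]
      refine ⟨fun m h => ?_, ih0⟩
      have he : Even (m + n) := by
        rw [Int.odd_iff] at h
        rw [Int.even_iff]
        omega
      have e := χ.liouville m n he
      rw [ih0, ih0, ← ψ.liouville m n he, ih1] at e
      exact mul_left_cancel₀ (ψ.pos _ _ _).ne' e
    | pred k ih =>
      obtain ⟨ih0, ih1⟩ := ih
      generalize (-k : ℤ) = n at ih0 ih1 ⊢
      refine ⟨ih1, fun m h => ?_⟩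
      have he : Even (m + (n - 1)) := by
        rw [Int.odd_iff] at h
        rw [Int.even_iff]
        omega
      have e := χ.liouville m (n - 1) he
      have hup : ∀ h, χ.val m (n - 1 + 1) h = ψ.val m (n - 1 + 1) h := by
        rw [sub_add_cancel]
        exact ih0 m
      rw [ih1, ih1, ← ψ.liouville m (n - 1) he, hup] at e
      exact mul_right_cancel₀ (ψ.pos _ _ _).ne' e
  ext m n h
  exact (key n).1 m h

/-- The solution of the discrete Liouville equation given by the Fock coordinates of the orbit of a
point of the Teichmüller space under `D^{1/N}`. -/
noncomputable def Teich.liouville {N : ℕ} (x : Teich N) : LiouvilleSolution N where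
  val m n _ := ((rootTwistEquiv N ^ n) x).fock (m + n)
  pos m n _ := Teich.fock_pos _ _
  liouville m n h := by
    obtain ⟨j, hj⟩ := even_iff_exists_two_mul.1 h
    have hdown : (rootTwistEquiv N ^ n) x = rootTwistEquiv N ((rootTwistEquiv N ^ (n - 1)) x) := by
      rw [← Equiv.Perm.mul_apply, ← _root_.zpow_one_add, add_sub_cancel]
    have hup : (rootTwistEquiv N ^ (n + 1)) x = rootTwistEquiv N ((rootTwistEquiv N ^ n) x) := by
      rw [← Equiv.Perm.mul_apply, ← _root_.zpow_one_add, add_comm]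
    -- With m + n = 2j, the lower factor χ_{m,n-1} is the inverse of f_{2j}(Dⁿ x), which is the
    -- leading factor of χ_{m,n+1} in `e2`.
    have e1 := fock_rootTwist_even ((rootTwistEquiv N ^ (n - 1)) x) j
    have e2 := fock_rootTwist_odd ((rootTwistEquiv N ^ n) x) j
    rw [← hdown] at e1
    rw [show m + (n - 1) = 2 * j - 1 by linarith, show m + (n + 1) = 2 * j + 1 by linarith,
      show m - 1 + n = 2 * j - 1 by linarith, show m + 1 + n = 2 * j + 1 by linarith, hup, e2, e1]
    have := (Teich.fock_pos ((rootTwistEquiv N ^ (n - 1)) x) (2 * j - 1)).ne'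
    field_simp
  periodic m n _ := by
    rw [show m + 2 * (N : ℤ) + n = m + n + 2 * N by ring, Teich.fock_periodic]

theorem Teich.liouville_zero {N : ℕ} (x : Teich N) (m : ℤ) (h : Odd m) :
    x.fock m = x.liouville.val m 0 (odd_zero h) := by
  simp [Teich.liouville]

theorem Teich.liouville_neg_one {N : ℕ} (x : Teich N) (m : ℤ) (h : Even m) :
    x.fock m = 1 / x.liouville.val m (-1) (odd_neg_one h) := by
  obtain ⟨j, rfl⟩ := even_iff_exists_two_mul.1 h
  -- Row -1 belongs to D⁻¹ x, and applying D to it turns its odd coordinates into the inverses of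
  -- the even coordinates of x.
  have e := fock_rootTwist_even ((rootTwistEquiv N ^ (-1 : ℤ)) x) j
  rwa [← Equiv.Perm.mul_apply, ← _root_.zpow_one_add, add_neg_cancel, zpow_zero,
    Equiv.Perm.one_apply] at e

theorem Teich.liouville_rootTwist {N : ℕ} (x : Teich N) (m n : ℤ) (h : Odd (m + n)) :
    (rootTwistEquiv N x).liouville.val m n h = x.liouville.val (m - 1) (n + 1) (odd_lightCone h) := by
  simp only [Teich.liouville]
  rw [← Equiv.Perm.mul_apply, ← _root_.zpow_add_one, show m - 1 + (n + 1) = m + n by ring]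

theorem Teich.liouville_injective (N : ℕ) : Function.Injective (Teich.liouville (N := N)) := by
  intro x y h
  refine Teich.fock_injective N (funext fun m => ?_)
  rcases Int.even_or_odd m with hm | hm
  · rw [x.liouville_neg_one m hm, y.liouville_neg_one m hm, h]
  · rw [x.liouville_zero m hm, y.liouville_zero m hm, h]

theorem Teich.liouville_surjective (N : ℕ) : Function.Surjective (Teich.liouville (N := N)) := by
  intro χ
  -- The candidate Fock coordinates are read off from rows -1 and 0.
  let f : ℤ → ℝ := fun m =>
    if h : Even m then 1 / χ.val m (-1) (odd_neg_one h)
    else χ.val m 0 (odd_zero (Int.not_even_iff_odd.1 h))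
  have hf : ∀ i, 0 < f i := fun i => by
    by_cases h : Even i
    · simp only [f, dif_pos h]
      exact one_div_pos.2 (χ.pos _ _ _)
    · simp only [f, dif_neg h]
      exact χ.pos _ _ _
  have hper : ∀ i, f (i + 2 * N) = f i := fun i => by
    by_cases h : Even i
    · have h' : Even (i + 2 * (N : ℤ)) := by grind
      simp only [f, dif_pos h, dif_pos h', χ.periodic i (-1) (odd_neg_one h)]
    · have h' : ¬Even (i + 2 * (N : ℤ)) := by grind
      simp only [f, dif_neg h, dif_neg h',
        χ.periodic i 0 (odd_zero (Int.not_even_iff_odd.1 h))]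
  obtain ⟨x, hx⟩ := Teich.exists_fock_eq f hf hper
  refine ⟨x, LiouvilleSolution.ext_initial (fun m h => ?_) fun m h => ?_⟩
  · rw [← x.liouville_zero m h, hx]
    simp only [f, dif_neg (Int.not_even_iff_odd.2 h)]
  · have e := x.liouville_neg_one m h
    rw [hx] at e
    simp only [f, dif_pos h] at e
    exact (inv_injective (by simpa using e)).symm

end AnnulusTeich

open AnnulusTeich
theorem mainTheorem1 (N : ℕ) (hN : 0 < N) :
    Function.Injective (Teich.fock (N := N)) ∧
    Set.range (Teich.fock (N := N)) =
      {f : ℤ → ℝ | (∀ i, 0 < f i) ∧ ∀ i, f (i + 2 * N) = f i} ∧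
    (∀ (x : Teich N) (j : ℤ),
      ((rootTwist N).act x).fock (2 * j) = 1 / x.fock (2 * j - 1) ∧
      ((rootTwist N).act x).fock (2 * j + 1) =
        x.fock (2 * j) * (1 + x.fock (2 * j - 1)) * (1 + x.fock (2 * j + 1))) ∧
    ∃ Φ : Teich N ≃ LiouvilleSolution N,
      (∀ (x : Teich N) (m : ℤ) (h : Odd m), x.fock m = (Φ x).val m 0 (odd_zero h)) ∧
      (∀ (x : Teich N) (m : ℤ) (h : Even m), x.fock m = 1 / (Φ x).val m (-1) (odd_neg_one h)) ∧
      ∀ (x : Teich N) (m n : ℤ) (h : Odd (m + n)),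
        (Φ ((rootTwist N).act x)).val m n h = (Φ x).val (m - 1) (n + 1) (odd_lightCone h) :=
  ⟨Teich.fock_injective N, Teich.range_fock N,
    -- `(rootTwist N).act` unfolds definitionally to `rootTwistEquiv N`.
    fun x j => ⟨fock_rootTwist_even x j, fock_rootTwist_odd x j⟩,
    Equiv.ofBijective Teich.liouville ⟨Teich.liouville_injective N, Teich.liouville_surjective N⟩,
    Teich.liouville_zero, Teich.liouville_neg_one, Teich.liouville_rootTwist⟩
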